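/- Let $n\ge 1$, let $\mathbb H$ be the skew field of real quaternions and $\mathrm M(n,\mathbb H)$ the ring of $n\times n$ quaternion matrices; $A^*$ is the conjugate transpose of $A$. For $A=(a_{ij})\in \mathrm M(n,\mathbb H)$ and $1\le j\le n$, the $j$-th column determinant is $$\operatorname{cdet}_j A=\sum_{\tau\in S_n}(-1)^{n-r}\,P_r(\tau)\cdots P_2(\tau)\,P_1(\tau),$$ where $r$ is the number of cycles of $\tau$ (fixed points included), the first cycle is the one containing $j$ and is opened by $c_1=j$, each of the other cycles is opened by its least element, and these elements satisfy $c_2<c_3<\dots<c_r$. If the $t$-th cycle is $c_t\mapsto d_1\mapsto d_2\mapsto\dots\mapsto d_l\mapsto c_t$, then $P_t(\tau)=a_{c_t d_l}\cdots a_{d_2 d_1}\,a_{d_1 c_t}$ (and $P_t(\tau)=a_{c_tc_t}$ for a fixed point). All column determinants of a Hermitian matrix $H$ have the same, real, value, denoted $\det H$; put $\operatorname{ddet}A=\det(A^*A)$. **Theorem.** Let $A,B\in \mathrm M(n,\mathbb H)$ with $\operatorname{ddet}A\neq 0$. Then the matrix equation $AX=B$ has a unique solution $X=(x_{ij})\in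 \mathrm M(n,\mathbb H)$, and for all $i,j=1,\dots,n$ $$x_{ij}=\frac{\operatorname{cdet}_i\big((A^*A)_{.i}(\hat b_{.j})\big)}{\operatorname{ddet}A},$$ where $\hat b_{.j}$ is the $j$-th column of $A^*B$ and $(A^*A)_{.i}(\hat b_{.j})$ is the matrix obtained from $A^*A$ by replacing its $i$-th column with $\hat b_{.j}$. -/

import Mathlib

open scoped Quaternion Matrix

namespace QuaternionCramer

noncomputable section

/-- The ordered product along the cycle of `τ` through `c`. If that cycle is
`c ↦ c₁ ↦ c₂ ↦ ⋯ ↦ cₗ ↦ c`, written from right to left as `(cₗ … c₂ c₁ c)`, then the product is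
`a_{c cₗ} ⋯ a_{c₂ c₁} a_{c₁ c}`. A fixed point `c` gives `a_{c c}`. -/
def cycleProd {n : ℕ} (A : Matrix (Fin n) (Fin n) ℍ) (τ : Equiv.Perm (Fin n)) (c : Fin n) : ℍ :=
  ((List.range (Function.minimalPeriod τ c)).reverse.map
    fun k => A ((τ ^ (k + 1)) c) ((τ ^ k) c)).prod

open Classical in
/-- The opening indices of the cycles of `τ` (fixed points included) other than the one through
`j`: each of these cycles is opened by its least element. -/
def otherLeaders {n : ℕ} (τ : Equiv.Perm (Fin n)) (j : Fin n) : Finset (Fin n) :=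
  Finset.univ.filter fun k => ¬ τ.SameCycle j k ∧ ∀ m, τ.SameCycle k m → k ≤ m

/-- The number `r` of cycles of `τ`, fixed points included: the cycle through `j`
and the others. -/
def numCycles {n : ℕ} (τ : Equiv.Perm (Fin n)) (j : Fin n) : ℕ :=
  (otherLeaders τ j).card + 1

/-- The `j`-th column determinant. In each monomial the cycle through `j` is the rightmost one and
the opening indices of the other cycles increase from right to left. -/
def cdet {n : ℕ} (j : Fin n) (A : Matrix (Fin n) (Fin n) ℍ) : ℍ :=
  ∑ τ : Equiv.Perm (Fin n), (-1 : ℍ) ^ (n - numCycles τ j) *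
    ((((otherLeaders τ j).sort (· ≤ ·)).reverse.map (cycleProd A τ)).prod * cycleProd A τ j)

/-- The determinant of a Hermitian quaternion matrix `H`. All column determinants of such a matrix
coincide (with each other and with all row determinants), and the first one is taken here.
It is used only for Hermitian matrices. -/
def hermDet {n : ℕ} [NeZero n] (H : Matrix (Fin n) (Fin n) ℍ) : ℍ :=
  cdet 0 H

/-- The double determinant `ddet A = det (A* A)`. -/
def ddet {n : ℕ} [NeZero n] (A : Matrix (Fin n) (Fin n) ℍ) : ℍ :=
  hermDet (Aᴴ * A)

end

end QuaternionCramer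

namespace QuaternionCramer

noncomputable section

open Equiv Equiv.Perm

variable {n : ℕ}

/-! ### Periods and agreement of permutations -/

/-! For Hermitian `H`, inverting one cycle of `τ` conjugates that cycle's product and preserves the
sign, so averaging over a cycle and its inverse replaces its product by its real part. Doing this
for every cycle not through `i` leaves real coefficients in front of the `i`-cycle, even after
column `i` is replaced (`cdet_updateCol_eq`). Hence `cdet i` is right-linear in column `i`
(`cdet_updateCol_sum`), and all `cdet i H` share one real value (`cdet_eq_sum_leaders`). If column
`i` is replaced by column `j ≠ i`, the terms of `τ` and `τ * swap i j` cancel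
(`cdet_updateCol_col_eq_zero`). Expanding a column of `H * X` therefore leaves only `cdet i H * X i
j`. With `H = Aᴴ * A`, this gives the formula; the same expansion yields a left inverse of `A`,
hence existence and uniqueness. -/

lemma minimalPeriod_perm_pos (τ : Perm (Fin n)) (c : Fin n) : 0 < Function.minimalPeriod τ c :=
  Function.minimalPeriod_pos_of_mem_periodicPts (τ.injective.mem_periodicPts c)

lemma isPeriodicPt_perm_iff {τ : Perm (Fin n)} {c : Fin n} {k : ℕ} :
    Function.IsPeriodicPt τ k c ↔ (τ ^ k) c = c := by
  rw [Function.IsPeriodicPt, Function.IsFixedPt, iterate_eq_pow]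

lemma pow_minimalPeriod_apply (τ : Perm (Fin n)) (c : Fin n) :
    (τ ^ Function.minimalPeriod τ c) c = c :=
  isPeriodicPt_perm_iff.1 (Function.isPeriodicPt_minimalPeriod τ c)

lemma pow_apply_ne_of_lt_minimalPeriod {τ : Perm (Fin n)} {c : Fin n} {k : ℕ} (hk : k ≠ 0)
    (hlt : k < Function.minimalPeriod τ c) : (τ ^ k) c ≠ c := fun h =>
  Function.not_isPeriodicPt_of_pos_of_lt_minimalPeriod hk hlt (isPeriodicPt_perm_iff.2 h)

lemma minimalPeriod_eq_of_pow_apply_eq {σ τ : Perm (Fin n)} {c : Fin n}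
    (h : ∀ k : ℕ, (σ ^ k) c = (τ ^ k) c) :
    Function.minimalPeriod σ c = Function.minimalPeriod τ c := by
  rw [Function.minimalPeriod_eq_minimalPeriod_iff]
  intro k
  rw [isPeriodicPt_perm_iff, isPeriodicPt_perm_iff, h]

lemma sameCycle_pow_self (τ : Perm (Fin n)) (c : Fin n) (k : ℕ) : τ.SameCycle c ((τ ^ k) c) :=
  ⟨k, by simp⟩

lemma sameCycle_iff_exists_nat_pow {τ : Perm (Fin n)} {c x : Fin n} :
    τ.SameCycle c x ↔ ∃ k : ℕ, (τ ^ k) c = x :=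
  ⟨fun h => h.exists_nat_pow_eq, fun ⟨k, hk⟩ => hk ▸ sameCycle_pow_self τ c k⟩

/-- Two permutations agreeing on the cycle of `c` have the same iterates at `c`. -/
lemma pow_apply_eq_of_eqOn_cycle {σ τ : Perm (Fin n)} {c : Fin n}
    (h : ∀ x, τ.SameCycle c x → σ x = τ x) (k : ℕ) : (σ ^ k) c = (τ ^ k) c := by
  induction k with
  | zero => rfl
  | succ k ih =>
    rw [pow_succ', pow_succ', Perm.mul_apply, Perm.mul_apply, ih, h _ (sameCycle_pow_self τ c k)]

lemma sameCycle_iff_of_eqOn_cycle {σ τ : Perm (Fin n)} {c : Fin n}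
    (h : ∀ x, τ.SameCycle c x → σ x = τ x) (x : Fin n) :
    σ.SameCycle c x ↔ τ.SameCycle c x := by
  simp only [sameCycle_iff_exists_nat_pow, pow_apply_eq_of_eqOn_cycle h]

/-! ### Partial products along a cycle -/

/-- The product of the first `m` factors, counted from the right, of the product along the cycle
of `τ` through `c`. -/
def pathProd (A : Matrix (Fin n) (Fin n) ℍ) (τ : Perm (Fin n)) (c : Fin n) (m : ℕ) : ℍ :=
  ((List.range m).reverse.map fun k => A ((τ ^ (k + 1)) c) ((τ ^ k) c)).prod

lemma cycleProd_eq_pathProd (A : Matrix (Fin n) (Fin n) ℍ) (τ : Perm (Fin n)) (c : Fin n) :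
    cycleProd A τ c = pathProd A τ c (Function.minimalPeriod τ c) := rfl

@[simp]
lemma pathProd_zero (A : Matrix (Fin n) (Fin n) ℍ) (τ : Perm (Fin n)) (c : Fin n) :
    pathProd A τ c 0 = 1 := rfl

lemma pathProd_succ (A : Matrix (Fin n) (Fin n) ℍ) (τ : Perm (Fin n)) (c : Fin n) (m : ℕ) :
    pathProd A τ c (m + 1) = A ((τ ^ (m + 1)) c) ((τ ^ m) c) * pathProd A τ c m := by
  simp [pathProd, List.range_succ]

lemma pathProd_add (A : Matrix (Fin n) (Fin n) ℍ) (τ : Perm (Fin n)) (c : Fin n) (a b : ℕ) :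
    pathProd A τ c (a + b) = pathProd A τ ((τ ^ a) c) b * pathProd A τ c a := by
  induction b with
  | zero => simp
  | succ b ih =>
    rw [← add_assoc, pathProd_succ, ih, pathProd_succ, mul_assoc, ← Perm.mul_apply,
      ← Perm.mul_apply, ← pow_add, ← pow_add, add_comm (b + 1), add_comm b a, add_assoc]

lemma pathProd_succ_right (A : Matrix (Fin n) (Fin n) ℍ) (τ : Perm (Fin n)) (c : Fin n) (m : ℕ) :
    pathProd A τ c (m + 1) = pathProd A τ (τ c) m * A (τ c) c := by
  rw [add_comm, pathProd_add, pow_one, pathProd_succ A τ c 0]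
  simp

lemma pathProd_congr {A B : Matrix (Fin n) (Fin n) ℍ} {σ τ : Perm (Fin n)} {c d : Fin n} {m : ℕ}
    (h : ∀ k < m, A ((σ ^ (k + 1)) c) ((σ ^ k) c) = B ((τ ^ (k + 1)) d) ((τ ^ k) d)) :
    pathProd A σ c m = pathProd B τ d m := by
  induction m with
  | zero => rfl
  | succ m ih =>
    rw [pathProd_succ, pathProd_succ, h m m.lt_succ_self,
      ih fun k hk => h k (hk.trans m.lt_succ_self)]

lemma cycleProd_eq_of_eqOn_cycle (A : Matrix (Fin n) (Fin n) ℍ) {σ τ : Perm (Fin n)} {c : Fin n}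
    (h : ∀ x, τ.SameCycle c x → σ x = τ x) : cycleProd A σ c = cycleProd A τ c := by
  have hp := pow_apply_eq_of_eqOn_cycle h
  rw [cycleProd_eq_pathProd, cycleProd_eq_pathProd, minimalPeriod_eq_of_pow_apply_eq hp]
  exact pathProd_congr fun k _ => by rw [hp, hp]

lemma cycleProd_updateCol_of_not_sameCycle (A : Matrix (Fin n) (Fin n) ℍ) {τ : Perm (Fin n)}
    {i c : Fin n} (h : ¬ τ.SameCycle i c) (b : Fin n → ℍ) :
    cycleProd (A.updateCol i b) τ c = cycleProd A τ c :=
  pathProd_congr fun k _ => Matrix.updateCol_ne fun e =>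
    h (e ▸ sameCycle_pow_self τ c k).symm

/-- The product along the cycle through `i` is linear on the right in the column `i`. -/
lemma cycleProd_updateCol_self (A : Matrix (Fin n) (Fin n) ℍ) (τ : Perm (Fin n)) (i : Fin n)
    (b : Fin n → ℍ) :
    cycleProd (A.updateCol i b) τ i =
      pathProd A τ (τ i) (Function.minimalPeriod τ i - 1) * b (τ i) := by
  rw [cycleProd_eq_pathProd]
  have hpos := minimalPeriod_perm_pos τ i
  obtain ⟨p, hp⟩ := Nat.exists_eq_succ_of_ne_zero hpos.ne'
  rw [hp, Nat.succ_eq_add_one, pathProd_succ_right, Matrix.updateCol_self, Nat.add_sub_cancel]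
  congr 1
  refine pathProd_congr fun k hk => Matrix.updateCol_ne ?_
  rw [← Perm.mul_apply, ← pow_succ]
  exact pow_apply_ne_of_lt_minimalPeriod k.succ_ne_zero (by omega)

lemma re_mul_comm (a b : ℍ) : (a * b).re = (b * a).re := by
  simp only [Quaternion.re_mul]
  ring

lemma minimalPeriod_apply_perm (τ : Perm (Fin n)) (c : Fin n) :
    Function.minimalPeriod τ (τ c) = Function.minimalPeriod τ c := by
  rw [Function.minimalPeriod_eq_minimalPeriod_iff]
  intro k
  rw [isPeriodicPt_perm_iff, isPeriodicPt_perm_iff, ← Perm.mul_apply, ← pow_succ, pow_succ',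
    Perm.mul_apply, τ.injective.eq_iff]

/-- Moving the starting point rotates the product cyclically, and `re (a * b) = re (b * a)`. -/
lemma re_cycleProd_apply (A : Matrix (Fin n) (Fin n) ℍ) (τ : Perm (Fin n)) (c : Fin n) :
    (cycleProd A τ (τ c)).re = (cycleProd A τ c).re := by
  rw [cycleProd_eq_pathProd, cycleProd_eq_pathProd, minimalPeriod_apply_perm]
  have hc := pow_minimalPeriod_apply τ c
  obtain ⟨p, hp⟩ := Nat.exists_eq_succ_of_ne_zero (minimalPeriod_perm_pos τ c).ne'
  rw [hp, Nat.succ_eq_add_one] at hc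
  rw [hp, Nat.succ_eq_add_one, pathProd_succ_right A τ c, re_mul_comm, pathProd_succ,
    ← Perm.mul_apply, ← Perm.mul_apply, ← pow_succ, ← pow_succ, hc, pow_succ', Perm.mul_apply, hc]

lemma re_cycleProd_eq_of_sameCycle (A : Matrix (Fin n) (Fin n) ℍ) {τ : Perm (Fin n)}
    {c d : Fin n} (h : τ.SameCycle c d) : (cycleProd A τ d).re = (cycleProd A τ c).re := by
  obtain ⟨k, rfl⟩ := sameCycle_iff_exists_nat_pow.1 h
  induction k with
  | zero => rfl
  | succ k ih =>
    rw [pow_succ', Perm.mul_apply, re_cycleProd_apply, ih (sameCycle_pow_self τ c k)]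

/-! ### Inverting one cycle -/

open Classical in
/-- The permutation `τ` with the cycle through `c` inverted. -/
def flip (τ : Perm (Fin n)) (c : Fin n) : Perm (Fin n) where
  toFun x := if τ.SameCycle c x then τ⁻¹ x else τ x
  invFun x := if τ.SameCycle c x then τ x else τ⁻¹ x
  left_inv x := by by_cases h : τ.SameCycle c x <;> simp [h]
  right_inv x := by by_cases h : τ.SameCycle c x <;> simp [h]

lemma flip_apply_of_sameCycle {τ : Perm (Fin n)} {c x : Fin n} (h : τ.SameCycle c x) :
    flip τ c x = τ⁻¹ x := if_pos h

lemma flip_apply_of_not_sameCycle {τ : Perm (Fin n)} {c x : Fin n} (h : ¬ τ.SameCycle c x) :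
    flip τ c x = τ x := if_neg h

lemma flip_eqOn_inv {τ : Perm (Fin n)} {c d : Fin n} (h : τ.SameCycle c d) (x : Fin n)
    (hx : (τ⁻¹).SameCycle d x) : flip τ c x = τ⁻¹ x :=
  flip_apply_of_sameCycle (h.trans (sameCycle_inv.1 hx))

lemma flip_eqOn {τ : Perm (Fin n)} {c d : Fin n} (h : ¬ τ.SameCycle c d) (x : Fin n)
    (hx : τ.SameCycle d x) : flip τ c x = τ x :=
  flip_apply_of_not_sameCycle fun hc => h (hc.trans hx.symm)

lemma sameCycle_flip {τ : Perm (Fin n)} {c x y : Fin n} :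
    (flip τ c).SameCycle x y ↔ τ.SameCycle x y := by
  by_cases h : τ.SameCycle c x
  · rw [sameCycle_iff_of_eqOn_cycle (flip_eqOn_inv h), sameCycle_inv]
  · rw [sameCycle_iff_of_eqOn_cycle (flip_eqOn h)]

lemma flip_flip (τ : Perm (Fin n)) (c : Fin n) : flip (flip τ c) c = τ := by
  ext x : 1
  by_cases h : τ.SameCycle c x
  · rw [flip_apply_of_sameCycle (sameCycle_flip.2 h), Perm.inv_eq_iff_eq,
      flip_apply_of_sameCycle (sameCycle_apply_right.2 h), Perm.inv_eq_iff_eq.2 rfl]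
  · rw [flip_apply_of_not_sameCycle (mt sameCycle_flip.1 h), flip_apply_of_not_sameCycle h]

lemma otherLeaders_flip (τ : Perm (Fin n)) (c j : Fin n) :
    otherLeaders (flip τ c) j = otherLeaders τ j := by
  simp only [otherLeaders, sameCycle_flip]

lemma numCycles_flip (τ : Perm (Fin n)) (c j : Fin n) :
    numCycles (flip τ c) j = numCycles τ j := by
  simp only [numCycles, otherLeaders_flip]

lemma cycleProd_flip_of_not_sameCycle (A : Matrix (Fin n) (Fin n) ℍ) {τ : Perm (Fin n)}
    {c d : Fin n} (h : ¬ τ.SameCycle c d) : cycleProd A (flip τ c) d = cycleProd A τ d :=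
  cycleProd_eq_of_eqOn_cycle A (flip_eqOn h)

/-- Walking the path backwards transposes each entry and reverses the factors; for Hermitian `H`
this is exactly what `star` does. -/
lemma pathProd_inv {H : Matrix (Fin n) (Fin n) ℍ} (hH : H.IsHermitian) (τ : Perm (Fin n))
    (c : Fin n) (m : ℕ) : pathProd H τ⁻¹ ((τ ^ m) c) m = star (pathProd H τ c m) := by
  induction m with
  | zero => simp
  | succ m ih =>
    have h : τ⁻¹ ((τ ^ (m + 1)) c) = (τ ^ m) c := by
      rw [pow_succ', Perm.mul_apply, Perm.inv_eq_iff_eq]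
    rw [pathProd_succ H τ, star_mul, hH.apply, ← ih, pathProd_succ_right, h]

lemma cycleProd_flip_self {H : Matrix (Fin n) (Fin n) ℍ} (hH : H.IsHermitian)
    (τ : Perm (Fin n)) (c : Fin n) : cycleProd H (flip τ c) c = star (cycleProd H τ c) := by
  rw [cycleProd_eq_of_eqOn_cycle H (flip_eqOn_inv (SameCycle.refl τ c)), cycleProd_eq_pathProd,
    cycleProd_eq_pathProd, ← pathProd_inv hH, pow_minimalPeriod_apply]
  congr 1
  rw [Function.minimalPeriod_eq_minimalPeriod_iff]
  intro k
  rw [isPeriodicPt_perm_iff, isPeriodicPt_perm_iff, inv_pow, Perm.inv_eq_iff_eq, eq_comm]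

/-! ### Leaders of cycles -/

lemma mem_otherLeaders {τ : Perm (Fin n)} {j k : Fin n} :
    k ∈ otherLeaders τ j ↔ ¬ τ.SameCycle j k ∧ ∀ m, τ.SameCycle k m → k ≤ m := by
  simp [otherLeaders]

lemma not_sameCycle_of_mem_otherLeaders {τ : Perm (Fin n)} {j c k : Fin n}
    (hc : c ∈ otherLeaders τ j) (hk : k ∈ otherLeaders τ j) (hne : k ≠ c) :
    ¬ τ.SameCycle c k := fun h =>
  hne (((mem_otherLeaders.1 hk).2 c h.symm).antisymm ((mem_otherLeaders.1 hc).2 k h))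

lemma exists_sameCycle_minimal (τ : Perm (Fin n)) (j : Fin n) :
    ∃ k, τ.SameCycle j k ∧ ∀ m, τ.SameCycle k m → k ≤ m := by
  obtain ⟨k, hk, hmin⟩ :=
    (wellFounded_lt (α := Fin n)).has_min {k | τ.SameCycle j k} ⟨j, SameCycle.refl τ j⟩
  exact ⟨k, hk, fun m hm => not_lt.1 (hmin m (SameCycle.trans hk hm))⟩

open Classical in
/-- The least elements of all cycles of `τ`, fixed points included. -/
def leaders (τ : Perm (Fin n)) : Finset (Fin n) :=
  Finset.univ.filter fun k => ∀ m, τ.SameCycle k m → k ≤ m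

lemma mem_leaders {τ : Perm (Fin n)} {k : Fin n} :
    k ∈ leaders τ ↔ ∀ m, τ.SameCycle k m → k ≤ m := by
  simp [leaders]

/-- The extra element is the minimum of the cycle through `j`, which `otherLeaders` omits. It makes
the cycle count independent of `j`. -/
lemma exists_leaders_eq_insert (τ : Perm (Fin n)) (j : Fin n) :
    ∃ k, τ.SameCycle j k ∧ k ∉ otherLeaders τ j ∧ leaders τ = insert k (otherLeaders τ j) := by
  obtain ⟨k, hk, hmin⟩ := exists_sameCycle_minimal τ j
  refine ⟨k, hk, fun h => (mem_otherLeaders.1 h).1 hk, ?_⟩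
  ext x
  rw [mem_leaders, Finset.mem_insert, mem_otherLeaders]
  constructor
  · intro hx
    by_cases h : τ.SameCycle j x
    · exact Or.inl ((hx k (h.symm.trans hk)).antisymm (hmin x (hk.symm.trans h)))
    · exact Or.inr ⟨h, hx⟩
  · rintro (rfl | h)
    · exact hmin
    · exact h.2

lemma numCycles_eq_card_leaders (τ : Perm (Fin n)) (j : Fin n) :
    numCycles τ j = (leaders τ).card := by
  obtain ⟨k, -, hk, h⟩ := exists_leaders_eq_insert τ j
  rw [h, Finset.card_insert_of_notMem hk, numCycles]

lemma numCycles_le (τ : Perm (Fin n)) (j : Fin n) : numCycles τ j ≤ n := by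
  rw [numCycles_eq_card_leaders]
  simpa using Finset.card_le_univ (leaders τ)

/-! ### Replacing cycle products by their real parts -/

lemma re_cycleProd_flip {H : Matrix (Fin n) (Fin n) ℍ} (hH : H.IsHermitian)
    (τ : Perm (Fin n)) (c d : Fin n) :
    (cycleProd H (flip τ c) d).re = (cycleProd H τ d).re := by
  by_cases h : τ.SameCycle c d
  · rw [re_cycleProd_eq_of_sameCycle H (sameCycle_flip.2 h), cycleProd_flip_self hH,
      Quaternion.re_star, re_cycleProd_eq_of_sameCycle H h]
  · rw [cycleProd_flip_of_not_sameCycle H h]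

/-- The product of the real parts of the cycle products of all cycles not through `j`. -/
def otherRe (H : Matrix (Fin n) (Fin n) ℍ) (τ : Perm (Fin n)) (j : Fin n) : ℝ :=
  ∏ k ∈ otherLeaders τ j, (cycleProd H τ k).re

lemma otherRe_flip {H : Matrix (Fin n) (Fin n) ℍ} (hH : H.IsHermitian)
    (τ : Perm (Fin n)) (c j : Fin n) : otherRe H (flip τ c) j = otherRe H τ j := by
  simp only [otherRe, otherLeaders_flip, re_cycleProd_flip hH]

/-- Additivity in a single factor of a noncommutative product; only the scalar `2` has to move past
other factors. -/
lemma prod_map_add_prod_map {ι : Type*} {l : List ι} (hl : l.Nodup) {c : ι} (hcl : c ∈ l)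
    {g g' h : ι → ℍ} (hg : ∀ k ∈ l, k ≠ c → g k = h k) (hg' : ∀ k ∈ l, k ≠ c → g' k = h k)
    (hc : g c + g' c = 2 * h c) :
    (l.map g).prod + (l.map g').prod = 2 * (l.map h).prod := by
  induction l with
  | nil => simp at hcl
  | cons a l ih =>
    simp only [List.map_cons, List.prod_cons]
    rw [List.nodup_cons] at hl
    by_cases hac : a = c
    · subst hac
      have hne : ∀ k ∈ l, k ≠ a := fun k hk e => hl.1 (e ▸ hk)
      rw [List.map_congr_left fun k hk => hg k (List.mem_cons_of_mem a hk) (hne k hk),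
        List.map_congr_left fun k hk => hg' k (List.mem_cons_of_mem a hk) (hne k hk),
        ← add_mul, hc, mul_assoc]
    · have hcl' : c ∈ l := (List.mem_cons.1 hcl).resolve_left fun e => hac e.symm
      rw [hg a List.mem_cons_self hac, hg' a List.mem_cons_self hac, ← mul_add,
        ih hl.2 hcl' (fun k hk => hg k (List.mem_cons_of_mem a hk))
          fun k hk => hg' k (List.mem_cons_of_mem a hk), two_mul, two_mul, mul_add]

lemma sum_eq_sum_of_involutive {α : Type*} [Fintype α] {φ : α → α} (hφ : Function.Involutive φ)
    {T T' : α → ℍ} (h : ∀ a, T a + T (φ a) = 2 * T' a) : ∑ a, T a = ∑ a, T' a := by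
  have h1 : ∑ a, T (φ a) = ∑ a, T a := Equiv.sum_comp (hφ.toPerm φ) T
  have h2 : 2 * ∑ a, T a = 2 * ∑ a, T' a := by
    rw [Finset.mul_sum _ T', ← Finset.sum_congr rfl fun a _ => h a, Finset.sum_add_distrib, h1,
      two_mul]
  have : CharZero ℍ := algebraRat.charZero ℍ
  exact mul_left_cancel₀ two_ne_zero h2

open Classical in
/-- The cycle product through `k`, replaced by its real part when `k ∈ S`. -/
def partialRe (H : Matrix (Fin n) (Fin n) ℍ) (S : Finset (Fin n)) (τ : Perm (Fin n))
    (k : Fin n) : ℍ :=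
  if k ∈ S then ((cycleProd H τ k).re : ℍ) else cycleProd H τ k

lemma partialRe_insert_of_ne (H : Matrix (Fin n) (Fin n) ℍ) (S : Finset (Fin n))
    (τ : Perm (Fin n)) {c k : Fin n} (h : k ≠ c) :
    partialRe H (insert c S) τ k = partialRe H S τ k := by
  simp [partialRe, h]

/-- Permutations are paired by inverting the cycle led by `c`; those where `c` leads no such cycle
are fixed by the pairing. The factor `f` stands for the `i`-cycle, which these inversions leave
alone. -/
lemma sum_partialRe_insert {H : Matrix (Fin n) (Fin n) ℍ} (hH : H.IsHermitian) (i : Fin n)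
    {f : Perm (Fin n) → ℍ} (hf : ∀ τ c, ¬ τ.SameCycle i c → f (flip τ c) = f τ)
    {S : Finset (Fin n)} {c : Fin n} (hc : c ∉ S) :
    ∑ τ : Perm (Fin n), (-1 : ℍ) ^ (n - numCycles τ i) *
      ((((otherLeaders τ i).sort (· ≤ ·)).reverse.map (partialRe H S τ)).prod * f τ) =
    ∑ τ : Perm (Fin n), (-1 : ℍ) ^ (n - numCycles τ i) *
      ((((otherLeaders τ i).sort (· ≤ ·)).reverse.map (partialRe H (insert c S) τ)).prod *
        f τ) := by
  let φ : Perm (Fin n) → Perm (Fin n) := fun τ => if c ∈ otherLeaders τ i then flip τ c else τ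
  have hφ : Function.Involutive φ := fun τ => by
    by_cases h : c ∈ otherLeaders τ i
    · simp [φ, h, otherLeaders_flip, flip_flip]
    · simp [φ, h]
  refine sum_eq_sum_of_involutive hφ fun τ => ?_
  by_cases h : c ∈ otherLeaders τ i
  · simp only [φ, h, if_true, otherLeaders_flip, numCycles_flip, hf τ c (mem_otherLeaders.1 h).1]
    have hlist := prod_map_add_prod_map (l := ((otherLeaders τ i).sort (· ≤ ·)).reverse) (c := c)
      (g := partialRe H S τ) (g' := partialRe H S (flip τ c)) (h := partialRe H (insert c S) τ)
      (List.nodup_reverse.2 (Finset.sort_nodup _ _)) (by simpa using h)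
      (fun k _ hk => (partialRe_insert_of_ne H S τ hk).symm)
      (fun k hkl hk => by
        have hkm : k ∈ otherLeaders τ i := by simpa using hkl
        rw [partialRe_insert_of_ne H S τ hk, partialRe, partialRe, cycleProd_flip_of_not_sameCycle H
          (not_sameCycle_of_mem_otherLeaders h hkm hk)])
      (by simp [partialRe, hc, cycleProd_flip_self hH, Quaternion.self_add_star])
    rw [← mul_add, ← add_mul, hlist]
    simp only [two_mul, add_mul, mul_add]
  · simp only [φ, h, if_false]
    rw [← two_mul, List.map_congr_left fun k hk => (partialRe_insert_of_ne H S τ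
      (fun e => h (by simpa [e] using hk) : k ≠ c)).symm]

lemma prod_map_coe_re (H : Matrix (Fin n) (Fin n) ℍ) (τ : Perm (Fin n)) (i : Fin n) :
    (((otherLeaders τ i).sort (· ≤ ·)).reverse.map (partialRe H Finset.univ τ)).prod =
      (otherRe H τ i : ℍ) := by
  have h1 : partialRe H Finset.univ τ =
      fun k => algebraMap ℝ ℍ ((cycleProd H τ k).re) := by
    ext1 k
    simp [partialRe, Quaternion.algebraMap_def]
  have h2 : (((otherLeaders τ i).sort (· ≤ ·)).reverse.map
      fun k => (cycleProd H τ k).re).prod = otherRe H τ i := by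
    rw [(((List.reverse_perm _).trans (Finset.sort_perm_toList _ _)).map _).prod_eq,
      Finset.prod_map_toList, otherRe]
  rw [h1, ← h2, ← Quaternion.algebraMap_def, map_list_prod, List.map_map]
  rfl

lemma sum_cycleProd_eq_sum_otherRe {H : Matrix (Fin n) (Fin n) ℍ} (hH : H.IsHermitian)
    (i : Fin n) {f : Perm (Fin n) → ℍ} (hf : ∀ τ c, ¬ τ.SameCycle i c → f (flip τ c) = f τ) :
    ∑ τ : Perm (Fin n), (-1 : ℍ) ^ (n - numCycles τ i) *
      ((((otherLeaders τ i).sort (· ≤ ·)).reverse.map (cycleProd H τ)).prod * f τ) =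
    ∑ τ : Perm (Fin n), (-1 : ℍ) ^ (n - numCycles τ i) * ((otherRe H τ i : ℍ) * f τ) := by
  have key : ∀ S : Finset (Fin n),
      ∑ τ : Perm (Fin n), (-1 : ℍ) ^ (n - numCycles τ i) *
        ((((otherLeaders τ i).sort (· ≤ ·)).reverse.map (partialRe H ∅ τ)).prod * f τ) =
      ∑ τ : Perm (Fin n), (-1 : ℍ) ^ (n - numCycles τ i) *
        ((((otherLeaders τ i).sort (· ≤ ·)).reverse.map (partialRe H S τ)).prod * f τ) := by
    intro S
    induction S using Finset.induction_on with
    | empty => rfl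
    | insert c S hc ih => rw [ih, sum_partialRe_insert hH i hf hc]
  have h := key Finset.univ
  simp only [prod_map_coe_re] at h
  rw [← h]
  have h0 : ∀ τ, partialRe H ∅ τ = cycleProd H τ := fun τ => by ext1 k; simp [partialRe]
  simp only [h0]

/-- The column determinant of a Hermitian matrix with one column replaced. -/
lemma cdet_updateCol_eq {H : Matrix (Fin n) (Fin n) ℍ} (hH : H.IsHermitian) (i : Fin n)
    (b : Fin n → ℍ) :
    cdet i (H.updateCol i b) = ∑ τ : Perm (Fin n), (-1 : ℍ) ^ (n - numCycles τ i) *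
      ((otherRe H τ i : ℍ) * cycleProd (H.updateCol i b) τ i) := by
  rw [← sum_cycleProd_eq_sum_otherRe hH i fun τ c h =>
    cycleProd_flip_of_not_sameCycle _ fun h' => h h'.symm]
  refine Finset.sum_congr rfl fun τ _ => ?_
  rw [List.map_congr_left fun k hk => cycleProd_updateCol_of_not_sameCycle H
    (mem_otherLeaders.1 (by simpa using hk)).1 b]

/-- The entry of column `i` is the rightmost factor of each monomial, and the replaced column occurs
nowhere else once the other cycles are real. -/
lemma cdet_updateCol_sum {H : Matrix (Fin n) (Fin n) ℍ} (hH : H.IsHermitian) (i : Fin n)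
    (b : Fin n → Fin n → ℍ) (x : Fin n → ℍ) :
    cdet i (H.updateCol i fun k => ∑ m, b m k * x m) =
      ∑ m, cdet i (H.updateCol i (b m)) * x m := by
  simp only [cdet_updateCol_eq hH, cycleProd_updateCol_self, Finset.mul_sum, Finset.sum_mul,
    mul_assoc]
  exact Finset.sum_comm

/-- Every column determinant of a Hermitian matrix equals the same real number. -/
lemma cdet_eq_sum_leaders {H : Matrix (Fin n) (Fin n) ℍ} (hH : H.IsHermitian) (i : Fin n) :
    cdet i H = ((∑ τ : Perm (Fin n), (-1 : ℝ) ^ (n - (leaders τ).card) *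
      ∏ k ∈ leaders τ, (cycleProd H τ k).re : ℝ) : ℍ) := by
  have h1 : cdet i H = ∑ τ : Perm (Fin n), (-1 : ℍ) ^ (n - numCycles τ i) *
      ((otherRe H τ i : ℍ) * cycleProd H τ i) :=
    sum_cycleProd_eq_sum_otherRe hH i fun τ c h =>
      cycleProd_flip_of_not_sameCycle _ fun h' => h h'.symm
  have h2 : cdet i H = ∑ τ : Perm (Fin n), (-1 : ℍ) ^ (n - numCycles τ i) *
      ((otherRe H τ i : ℍ) * ((cycleProd H τ i).re : ℍ)) := by
    rw [h1]
    -- With no column replaced, the `i`-cycle can be averaged with its inverse as well.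
    refine sum_eq_sum_of_involutive (φ := fun τ => flip τ i) (fun τ => flip_flip τ i) fun τ => ?_
    rw [numCycles_flip, otherRe_flip hH, cycleProd_flip_self hH, ← mul_add, ← mul_add,
      Quaternion.self_add_star]
    simp only [two_mul, mul_add]
  rw [h2, ← Quaternion.algebraMap_def, map_sum]
  refine Finset.sum_congr rfl fun τ _ => ?_
  obtain ⟨k, hk, hkn, hins⟩ := exists_leaders_eq_insert τ i
  rw [numCycles_eq_card_leaders, map_mul, hins, Finset.prod_insert hkn, ← hins,
    re_cycleProd_eq_of_sameCycle H hk, map_mul, Algebra.commutes]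
  simp [Quaternion.algebraMap_def, otherRe]

/-! ### Merging and splitting cycles by a transposition -/

lemma mul_swap_apply_of_ne {τ : Perm (Fin n)} {i j x : Fin n} (hi : x ≠ i) (hj : x ≠ j) :
    (τ * swap i j) x = τ x := by
  rw [Perm.mul_apply, swap_apply_of_ne_of_ne hi hj]

lemma mul_swap_eqOn {τ : Perm (Fin n)} {i j k : Fin n} (hi : ¬ τ.SameCycle i k)
    (hj : ¬ τ.SameCycle j k) (x : Fin n) (hx : τ.SameCycle k x) :
    (τ * swap i j) x = τ x :=
  mul_swap_apply_of_ne (fun e => hi (e ▸ hx.symm)) (fun e => hj (e ▸ hx.symm))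

/-- If `i` and `j` lie on different cycles of `τ`, then in `τ * swap i j` the point `i` first
follows the cycle of `j`. -/
lemma mul_swap_pow_apply {τ : Perm (Fin n)} {i j : Fin n} (h : ¬ τ.SameCycle i j) {k : ℕ}
    (hk : k < Function.minimalPeriod τ j) :
    ((τ * swap i j) ^ (k + 1)) i = (τ ^ (k + 1)) j := by
  induction k with
  | zero => simp
  | succ k ih =>
    rw [pow_succ', Perm.mul_apply, ih (by omega), pow_succ' τ (k + 1), Perm.mul_apply τ]
    exact mul_swap_apply_of_ne (fun e => h (e ▸ (sameCycle_pow_self τ j (k + 1)).symm))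
      (pow_apply_ne_of_lt_minimalPeriod k.succ_ne_zero hk)

lemma mul_swap_pow_minimalPeriod_apply {τ : Perm (Fin n)} {i j : Fin n}
    (h : ¬ τ.SameCycle i j) :
    ((τ * swap i j) ^ Function.minimalPeriod τ j) i = j := by
  obtain ⟨p, hp⟩ := Nat.exists_eq_succ_of_ne_zero (minimalPeriod_perm_pos τ j).ne'
  have := mul_swap_pow_apply h (k := p) (by omega)
  rwa [← Nat.succ_eq_add_one, ← hp, pow_minimalPeriod_apply] at this

lemma sameCycle_mul_swap {τ : Perm (Fin n)} {i j : Fin n} (h : ¬ τ.SameCycle i j) :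
    (τ * swap i j).SameCycle i j :=
  sameCycle_iff_exists_nat_pow.2 ⟨_, mul_swap_pow_minimalPeriod_apply h⟩

/-- The point `i` runs through the old cycle of `j`, reaches `j`, then runs through the old cycle of
`i`. An earlier return would put `i` on the cycle of `j` or shorten its own period. -/
lemma minimalPeriod_mul_swap {τ : Perm (Fin n)} {i j : Fin n} (h : ¬ τ.SameCycle i j) :
    Function.minimalPeriod (τ * swap i j) i =
      Function.minimalPeriod τ j + Function.minimalPeriod τ i := by
  have hij := mul_swap_pow_minimalPeriod_apply h
  have hji := mul_swap_pow_minimalPeriod_apply fun h' => h h'.symm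
  have hji' : ∀ k < Function.minimalPeriod τ i,
      ((τ * swap i j) ^ (k + 1)) j = (τ ^ (k + 1)) i := fun k hk => by
    rw [swap_comm, mul_swap_pow_apply (fun h' => h h'.symm) hk]
  rw [swap_comm] at hji
  have hpos := minimalPeriod_perm_pos τ j
  apply le_antisymm
  · refine Function.IsPeriodicPt.minimalPeriod_le (by omega) (isPeriodicPt_perm_iff.2 ?_)
    rw [add_comm, pow_add, Perm.mul_apply, hij, hji]
  · by_contra! hlt
    have hper := pow_minimalPeriod_apply (τ * swap i j) i
    have hq := minimalPeriod_perm_pos (τ * swap i j) i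
    generalize Function.minimalPeriod (τ * swap i j) i = q at *
    by_cases hle : q ≤ Function.minimalPeriod τ j
    · obtain ⟨k, rfl⟩ := Nat.exists_eq_succ_of_ne_zero hq.ne'
      rw [Nat.succ_eq_add_one, mul_swap_pow_apply h hle] at hper
      exact h (hper ▸ (sameCycle_pow_self τ j (k + 1)).symm)
    · obtain ⟨k, rfl⟩ := Nat.exists_eq_add_of_lt (not_le.1 hle)
      rw [add_assoc, add_comm, pow_add, Perm.mul_apply, hij, hji' k (by omega)] at hper
      exact pow_apply_ne_of_lt_minimalPeriod k.succ_ne_zero (by omega) hper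

/-- If `i` and `j` lie on the same cycle of `τ`, then `τ * swap i j` splits it. -/
lemma not_sameCycle_mul_swap {τ : Perm (Fin n)} {i j : Fin n} (hij : i ≠ j)
    (h : τ.SameCycle i j) : ¬ (τ * swap i j).SameCycle i j := by
  classical
  have hex : ∃ m : ℕ, (τ ^ m) j = i := sameCycle_iff_exists_nat_pow.1 h.symm
  set m := Nat.find hex with hm
  have hmi : (τ ^ m) j = i := Nat.find_spec hex
  have hmin : ∀ k < m, (τ ^ k) j ≠ i := fun k hk => Nat.find_min hex hk
  have hm0 : 0 < m := Nat.pos_of_ne_zero fun e => hij (by rw [e] at hmi; exact hmi.symm)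
  have hne : ∀ k, 0 < k → k ≤ m → (τ ^ k) j ≠ j := fun k hk hkm e => by
    -- A return to `j` after `k` steps would make `i` reachable from `j` in only `m - k` steps.
    apply hmin (m - k) (by omega)
    nth_rewrite 1 [← e]
    rw [← Perm.mul_apply, ← pow_add, Nat.sub_add_cancel hkm, hmi]
  -- The new orbit of `i` stays on the arc `τ j, …, τ ^ m j = i`, which avoids `j`.
  have hiter : ∀ t : ℕ, ∃ k, 0 < k ∧ k ≤ m ∧ ((τ * swap i j) ^ t) i = (τ ^ k) j := by
    intro t
    induction t with
    | zero => exact ⟨m, hm0, le_rfl, hmi.symm⟩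
    | succ t ih =>
      obtain ⟨k, hk0, hkm, hk⟩ := ih
      rw [pow_succ', Perm.mul_apply, hk]
      rcases hkm.eq_or_lt with rfl | hlt
      · exact ⟨1, one_pos, hm0, by rw [hmi, Perm.mul_apply, swap_apply_left, pow_one]⟩
      · exact ⟨k + 1, k.succ_pos, hlt, by
          rw [mul_swap_apply_of_ne (hmin k hlt) (hne k hk0 hkm), pow_succ', Perm.mul_apply]⟩
  intro hs
  obtain ⟨t, ht⟩ := sameCycle_iff_exists_nat_pow.1 hs
  obtain ⟨k, hk0, hkm, hk⟩ := hiter t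
  exact hne k hk0 hkm (hk.symm.trans ht)

lemma sameCycle_mul_swap_iff {τ : Perm (Fin n)} {i j : Fin n} (h : ¬ τ.SameCycle i j)
    (k : Fin n) : (τ * swap i j).SameCycle i k ↔ τ.SameCycle i k ∨ τ.SameCycle j k := by
  have hs := sameCycle_mul_swap h
  constructor
  · intro hk
    by_contra! hn
    exact hn.1 ((sameCycle_iff_of_eqOn_cycle (mul_swap_eqOn hn.1 hn.2) i).1 hk.symm).symm
  · intro hk
    by_contra hn
    have hnj : ¬ (τ * swap i j).SameCycle j k := fun h' => hn (hs.trans h')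
    have he := sameCycle_iff_of_eqOn_cycle (mul_swap_eqOn hn hnj)
    -- The agreement lemma was applied to `τ * swap i j`; a second swap gives back `τ`.
    rw [mul_assoc, swap_mul_self, mul_one] at he
    rcases hk with hk | hk
    · exact hn ((he i).1 hk.symm).symm
    · exact hnj ((he j).1 hk.symm).symm

lemma mem_otherLeaders_mul_swap {τ : Perm (Fin n)} {i j : Fin n} (h : ¬ τ.SameCycle i j)
    {k : Fin n} :
    k ∈ otherLeaders (τ * swap i j) i ↔ k ∈ otherLeaders τ i ∧ ¬ τ.SameCycle j k := by
  simp only [mem_otherLeaders, sameCycle_mul_swap_iff h, not_or]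
  constructor
  · rintro ⟨⟨hi, hj⟩, hk⟩
    simp only [sameCycle_iff_of_eqOn_cycle (mul_swap_eqOn hi hj)] at hk
    exact ⟨⟨hi, hk⟩, hj⟩
  · rintro ⟨⟨hi, hk⟩, hj⟩
    simp only [sameCycle_iff_of_eqOn_cycle (mul_swap_eqOn hi hj)]
    exact ⟨⟨hi, hj⟩, hk⟩

lemma exists_otherLeaders_eq_insert {τ : Perm (Fin n)} {i j : Fin n}
    (h : ¬ τ.SameCycle i j) :
    ∃ k, τ.SameCycle j k ∧ k ∉ otherLeaders (τ * swap i j) i ∧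
      otherLeaders τ i = insert k (otherLeaders (τ * swap i j) i) := by
  obtain ⟨k, hk, hmin⟩ := exists_sameCycle_minimal τ j
  refine ⟨k, hk, fun h' => ((mem_otherLeaders_mul_swap h).1 h').2 hk, ?_⟩
  ext x
  rw [Finset.mem_insert, mem_otherLeaders_mul_swap h]
  constructor
  · intro hx
    by_cases hj : τ.SameCycle j x
    · exact Or.inl (((mem_otherLeaders.1 hx).2 k (hj.symm.trans hk)).antisymm
        (hmin x (hk.symm.trans hj)))
    · exact Or.inr ⟨hx, hj⟩
  · rintro (rfl | hx)
    · exact mem_otherLeaders.2 ⟨fun hi => h (hi.trans hk.symm), hmin⟩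
    · exact hx.1

lemma numCycles_mul_swap {τ : Perm (Fin n)} {i j : Fin n} (h : ¬ τ.SameCycle i j) :
    numCycles τ i = numCycles (τ * swap i j) i + 1 := by
  obtain ⟨k, -, hk, he⟩ := exists_otherLeaders_eq_insert h
  rw [numCycles, numCycles, he, Finset.card_insert_of_notMem hk]

lemma sign_mul_swap {τ : Perm (Fin n)} {i j : Fin n} (h : ¬ τ.SameCycle i j) :
    (-1 : ℍ) ^ (n - numCycles (τ * swap i j) i) = -(-1 : ℍ) ^ (n - numCycles τ i) := by
  have h1 := numCycles_mul_swap h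
  have h2 := numCycles_le τ i
  rw [show n - numCycles (τ * swap i j) i = n - numCycles τ i + 1 by omega, pow_succ, mul_neg,
    mul_one]

lemma cycleProd_mul_swap_of_not_sameCycle (H : Matrix (Fin n) (Fin n) ℍ) {τ : Perm (Fin n)}
    {i j k : Fin n} (hi : ¬ τ.SameCycle i k) (hj : ¬ τ.SameCycle j k) :
    cycleProd H (τ * swap i j) k = cycleProd H τ k :=
  cycleProd_eq_of_eqOn_cycle H (mul_swap_eqOn hi hj)

/-- The cycle of `j` is the one absorbed by merging; its real part may be computed from any starting
point. -/
lemma otherRe_eq_mul {τ : Perm (Fin n)} {i j : Fin n} (H : Matrix (Fin n) (Fin n) ℍ)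
    (h : ¬ τ.SameCycle i j) :
    otherRe H τ i = otherRe H (τ * swap i j) i * (cycleProd H τ j).re := by
  obtain ⟨k, hjk, hk, he⟩ := exists_otherLeaders_eq_insert h
  rw [otherRe, he, Finset.prod_insert hk, re_cycleProd_eq_of_sameCycle H hjk, mul_comm, otherRe]
  congr 1
  refine Finset.prod_congr rfl fun x hx => ?_
  have hx' := (mem_otherLeaders_mul_swap h).1 hx
  rw [cycleProd_mul_swap_of_not_sameCycle H (mem_otherLeaders.1 hx'.1).1 hx'.2]

lemma otherRe_flip_mul_swap {H : Matrix (Fin n) (Fin n) ℍ} (hH : H.IsHermitian)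
    {τ : Perm (Fin n)} {i j : Fin n} (h : ¬ τ.SameCycle i j) (c : Fin n) :
    otherRe H (flip τ c * swap i j) i = otherRe H (τ * swap i j) i := by
  have h' : ¬ (flip τ c).SameCycle i j := mt sameCycle_flip.1 h
  have hl : otherLeaders (flip τ c * swap i j) i = otherLeaders (τ * swap i j) i := by
    ext k
    rw [mem_otherLeaders_mul_swap h, mem_otherLeaders_mul_swap h', otherLeaders_flip,
      sameCycle_flip]
  rw [otherRe, otherRe, hl]
  refine Finset.prod_congr rfl fun x hx => ?_
  have hx' := (mem_otherLeaders_mul_swap h).1 hx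
  have hi := (mem_otherLeaders.1 hx'.1).1
  rw [cycleProd_mul_swap_of_not_sameCycle H hi hx'.2, cycleProd_mul_swap_of_not_sameCycle H
    (mt sameCycle_flip.1 hi) (mt sameCycle_flip.1 hx'.2), re_cycleProd_flip hH]

lemma pathProd_mul_swap {M : Matrix (Fin n) (Fin n) ℍ} {τ : Perm (Fin n)} {i j : Fin n}
    (hM : ∀ x, M x i = M x j) (h : ¬ τ.SameCycle i j) :
    pathProd M (τ * swap i j) i (Function.minimalPeriod τ j) = cycleProd M τ j := by
  refine pathProd_congr fun k hk => ?_
  rw [mul_swap_pow_apply h hk]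
  cases k with
  | zero => exact hM _
  | succ k => rw [mul_swap_pow_apply h (k.lt_succ_self.trans hk)]

/-- For a matrix with equal columns `i` and `j`, merging two cycles multiplies their products. -/
lemma cycleProd_mul_swap {M : Matrix (Fin n) (Fin n) ℍ} {τ : Perm (Fin n)} {i j : Fin n}
    (hM : ∀ x, M x i = M x j) (h : ¬ τ.SameCycle i j) :
    cycleProd M (τ * swap i j) i = cycleProd M τ i * cycleProd M τ j := by
  rw [cycleProd_eq_pathProd, minimalPeriod_mul_swap h, pathProd_add,
    mul_swap_pow_minimalPeriod_apply h, pathProd_mul_swap hM h, swap_comm,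
    pathProd_mul_swap (fun x => (hM x).symm) fun h' => h h'.symm]

/-! ### Cramer's rule -/

lemma cdet_updateCol_col_eq_zero {H : Matrix (Fin n) (Fin n) ℍ} (hH : H.IsHermitian)
    {i j : Fin n} (hij : i ≠ j) : cdet i (H.updateCol i (H.col j)) = 0 := by
  classical
  set M := H.updateCol i (H.col j) with hMdef
  have hM : ∀ x, M x i = M x j := fun x => by
    rw [hMdef, Matrix.updateCol_self, Matrix.updateCol_ne hij.symm, Matrix.col_apply]
  rw [cdet_updateCol_eq hH]
  -- When `i` and `j` lie on different cycles, `U` undoes the averaging on the cycle of `j`: its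
  -- full product, placed right of the `i`-cycle, replaces its real part. This is the shape of the
  -- product along the merged cycle.
  let U : Perm (Fin n) → ℍ := fun τ => (-1 : ℍ) ^ (n - numCycles τ i) *
    if τ.SameCycle i j then (otherRe H τ i : ℍ) * cycleProd M τ i
    else (otherRe H (τ * swap i j) i : ℍ) * (cycleProd M τ i * cycleProd H τ j)
  let φ : Perm (Fin n) → Perm (Fin n) := fun τ => if τ.SameCycle i j then τ else flip τ j
  have hφ : Function.Involutive φ := fun τ => by
    by_cases h : τ.SameCycle i j
    · simp [φ, h]
    · simp [φ, h, sameCycle_flip, flip_flip]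
  have hU : ∑ τ, U τ = ∑ τ : Perm (Fin n), (-1 : ℍ) ^ (n - numCycles τ i) *
      ((otherRe H τ i : ℍ) * cycleProd M τ i) := by
    refine sum_eq_sum_of_involutive hφ fun τ => ?_
    by_cases h : τ.SameCycle i j
    · simp only [φ, U, h, if_true, two_mul]
    · simp only [φ, U, h, if_false, sameCycle_flip, numCycles_flip, otherRe_flip_mul_swap hH h,
        cycleProd_flip_self hH, cycleProd_flip_of_not_sameCycle M fun h' => h h'.symm,
        otherRe_eq_mul H h]
      rw [← mul_add, ← mul_add, ← mul_add, Quaternion.self_add_star, Quaternion.coe_mul,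
        mul_assoc (Quaternion.coe _), Quaternion.coe_commutes _ (cycleProd M τ i)]
      simp only [two_mul, mul_add]
  -- Merging multiplies the two cycle products, keeps the remaining cycles and changes the cycle
  -- count by one, hence the sign.
  have hsplit : ∀ τ : Perm (Fin n), ¬ τ.SameCycle i j → U (τ * swap i j) = -U τ := by
    intro τ h
    have hMj : cycleProd M τ j = cycleProd H τ j := cycleProd_updateCol_of_not_sameCycle H h _
    simp only [U, h, if_false, sameCycle_mul_swap h, if_true]
    rw [sign_mul_swap h, cycleProd_mul_swap hM h, hMj, neg_mul]
  have hneg : ∀ τ : Perm (Fin n), U τ + U (τ * swap i j) = 2 * 0 := by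
    intro τ
    by_cases h : τ.SameCycle i j
    · have h' := hsplit _ (not_sameCycle_mul_swap hij h)
      rw [mul_assoc, swap_mul_self, mul_one] at h'
      rw [h']
      simp
    · rw [hsplit τ h]
      simp
  rw [← hU, sum_eq_sum_of_involutive (φ := fun τ => τ * swap i j)
    (fun τ => by simp [mul_assoc]) hneg, Finset.sum_const_zero]

/-- Column `j` of `H * X` is a right combination of the columns of `H`; every column except the
`i`-th contributes zero. -/
lemma cdet_updateCol_mul {H : Matrix (Fin n) (Fin n) ℍ} (hH : H.IsHermitian)
    (X : Matrix (Fin n) (Fin n) ℍ) (i j : Fin n) :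
    cdet i (H.updateCol i ((H * X).col j)) = cdet i H * X i j := by
  have h1 : (H * X).col j = fun k => ∑ m, H.col m k * X m j := by
    ext1 k
    simp [Matrix.mul_apply]
  rw [h1, cdet_updateCol_sum hH i (fun m => H.col m) fun m => X m j, Finset.sum_eq_single i]
  · congr 2
    exact Matrix.updateCol_eq_self H i
  · intro m _ hm
    rw [cdet_updateCol_col_eq_zero hH hm.symm, zero_mul]
  · simp

/-- The left adjugate of a Hermitian matrix, made of the left cofactors of its columns. -/
lemma exists_mul_eq_diagonal_cdet {H : Matrix (Fin n) (Fin n) ℍ} (hH : H.IsHermitian) :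
    ∃ L : Matrix (Fin n) (Fin n) ℍ, L * H = Matrix.diagonal fun i => cdet i H := by
  refine ⟨Matrix.of fun i k => cdet i (H.updateCol i (Pi.single k 1)), ?_⟩
  ext1 i j
  have h1 : H.col j = fun k => ∑ m, (Pi.single m 1 : Fin n → ℍ) k * H m j := by
    ext1 k
    simp [Pi.single_apply]
  have h2 : cdet i (H.updateCol i (H.col j)) =
      ∑ m, cdet i (H.updateCol i (Pi.single m 1)) * H m j := by
    rw [h1, cdet_updateCol_sum hH i (fun m => Pi.single m 1) fun m => H m j]
  rw [Matrix.mul_apply]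
  simp only [Matrix.of_apply]
  rw [← h2]
  by_cases hij : i = j
  · subst hij
    rw [Matrix.diagonal_apply_eq]
    congr 1
    exact Matrix.updateCol_eq_self H i
  · rw [cdet_updateCol_col_eq_zero hH hij, Matrix.diagonal_apply_ne _ hij]

lemma cdet_conjTranspose_mul_self [NeZero n] (A : Matrix (Fin n) (Fin n) ℍ) (i : Fin n) :
    cdet i (Aᴴ * A) = ddet A := by
  have hH : (Aᴴ * A).IsHermitian := Matrix.isHermitian_conjTranspose_mul_self A
  rw [ddet, hermDet, cdet_eq_sum_leaders hH, cdet_eq_sum_leaders hH]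

end

end QuaternionCramer

theorem theorem3p1 (n : ℕ) [NeZero n] (A B : Matrix (Fin n) (Fin n) ℍ)
    (hA : QuaternionCramer.ddet A ≠ 0) :
    (∃! X : Matrix (Fin n) (Fin n) ℍ, A * X = B) ∧
      ∀ X : Matrix (Fin n) (Fin n) ℍ, A * X = B →
        ∀ i j : Fin n,
          X i j = QuaternionCramer.cdet i ((Aᴴ * A).updateCol i ((Aᴴ * B).col j)) /
            QuaternionCramer.ddet A := by
  have hH : (Aᴴ * A).IsHermitian := Matrix.isHermitian_conjTranspose_mul_self A
  -- Reality makes `ddet A` central, so the quotient in the formula does not depend on the side of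
  -- division.
  obtain ⟨r, hr⟩ : ∃ r : ℝ, QuaternionCramer.ddet A = (r : ℍ) :=
    ⟨_, QuaternionCramer.cdet_eq_sum_leaders hH 0⟩
  obtain ⟨L, hL⟩ := QuaternionCramer.exists_mul_eq_diagonal_cdet hH
  obtain ⟨C, hCA⟩ : ∃ C : Matrix (Fin n) (Fin n) ℍ, C * A = 1 := by
    refine ⟨Matrix.diagonal (fun _ => (QuaternionCramer.ddet A)⁻¹) * L * Aᴴ, ?_⟩
    rw [mul_assoc, mul_assoc, hL, Matrix.diagonal_mul_diagonal]
    simp [QuaternionCramer.cdet_conjTranspose_mul_self, hA]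
  -- One-sided inverses of square matrices over a division ring are two-sided.
  have hAC : A * C = 1 := mul_eq_one_comm.1 hCA
  refine ⟨⟨C * B, by simp only [← mul_assoc, hAC, one_mul], fun Y hY => ?_⟩, fun X hX i j => ?_⟩
  · rw [← hY, ← mul_assoc, hCA, one_mul]
  · rw [← hX, ← mul_assoc, QuaternionCramer.cdet_updateCol_mul hH,
      QuaternionCramer.cdet_conjTranspose_mul_self, eq_div_iff hA, hr, Quaternion.coe_commutes]
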